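/- Let $k$ be an infinite field with $\operatorname{char} k\neq 2$, and let $a,b,c,d\in k$ be such that $a$ and $b$ are not squares in $k$ and at least one of $c,d$ is non-zero. Let $L_0=k(t_1,t_2,t_3,t_4)$ be a field extension of $k$ of transcendence degree $2$ over $k$ with $$t_1^2-at_2^2=b,\qquad t_3^2-at_4^2=2ct_1+d .$$ A finitely generated field extension $L$ of $k$ is called $k$-rational if it is $k$-isomorphic to the quotient field of a polynomial ring $k[x_1,\dots,x_n]$; stably $k$-rational if $L(y_1,\dots,y_m)$ is $k$-rational for some $m\ge 0$ and some $y_1,\dots,y_m$ algebraically independent over $L$; and $k$-unirational if it is $k$-isomorphic to a subfield of some $k$-rational field. For a field $K$ with $\operatorname{char}K\ne 2$ and non-zero $p,q\in K$, let $(p,q)_{2,K}$ denote the class in the Brauer group $\mathrm{Br}(K)$ of the quaternion algebra over $K$ with $K$-basis $1,u,v,uv$ and relations $u^2=p$, $v^2=q$, $uv=-vu$; it is zero if it equals the class of $K$. Let $k'=k(\sqrt{d^2-4bc^2})$ (so $k'=k$ if $d^2-4bc^2$ is a square in $k$). Then the following statements are equivalent: (i) $L_0$ is $k$-rational; (ii)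 $L_0$ is stably $k$-rational; (iii) $L_0$ is $k$-unirational; (iv) there exist $\alpha,\beta,\gamma,\delta\in k$ such that $\alpha^2-a\beta^2=b$ and $\gamma^2-a\delta^2=2c\alpha+d$; (v) there exist $\alpha,\beta\in k$ such that $\alpha^2-a\beta^2=b$ and either $-2c\alpha+d=0$, or $-2c\alpha+d\neq 0$ and $(a,-2c\alpha+d)_{2,k'}=0$; (vi) $(a,b)_{2,k}=0$ and, for all $\alpha,\beta\in k$ with $\alpha^2-a\beta^2=b$, either $-2c\alpha+d=0$, or $-2c\alpha+d\neq 0$ and $(a,-2c\alpha+d)_{2,k'}=0$. -/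

import Mathlib

open scoped Quaternion

universe u v

/-! ### Rationality of field extensions -/

/-- `L` is `k`-rational: it is `k`-isomorphic to the quotient field of a polynomial ring over `k`
in finitely many variables. -/
def IsRationalExt (k : Type u) (L : Type v) [Field k] [Field L] [Algebra k L] : Prop :=
  ∃ n : ℕ, Nonempty (L ≃ₐ[k] FractionRing (MvPolynomial (Fin n) k))

/-- `L` is stably `k`-rational: `L(y₁, …, yₘ)` is `k`-rational for some `m`, where the `yᵢ` are
algebraically independent over `L`. -/
def IsStablyRationalExt (k : Type u) (L : Type v) [Field k] [Field L] [Algebra k L] : Prop :=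
  ∃ m : ℕ, IsRationalExt k (FractionRing (MvPolynomial (Fin m) L))

/-- `L` is `k`-unirational: it is `k`-isomorphic to a subfield of some `k`-rational field. -/
def IsUnirationalExt (k : Type u) (L : Type v) [Field k] [Field L] [Algebra k L] : Prop :=
  ∃ n : ℕ, Nonempty (L →ₐ[k] FractionRing (MvPolynomial (Fin n) k))

/-! ### Quaternion algebras and their classes in the Brauer group -/

section Quaternion

variable {K : Type u} [Field K] {a b : K}

theorem QuaternionAlgebra.isCentral_of_ne_zero (h2 : (2 : K) ≠ 0) (ha : a ≠ 0) :
    Algebra.IsCentral K ℍ[K,a,b] := by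
  refine ⟨fun q hq => ?_⟩
  rw [Subalgebra.mem_center_iff] at hq
  have hi := hq ⟨0, 1, 0, 0⟩
  have hj := hq ⟨0, 0, 1, 0⟩
  have aux : ∀ s t : K, s ≠ 0 → s * t = -(s * t) → t = 0 := by
    intro s t hs h
    have h3 : 2 * (s * t) = 0 := by linear_combination h
    simpa [h2, hs] using h3
  have h1 := congrArg QuaternionAlgebra.imJ hi
  have h3 := congrArg QuaternionAlgebra.imK hi
  have h4 := congrArg QuaternionAlgebra.imK hj
  simp at h1 h3 h4
  have e1 : q.imI = 0 := aux 1 _ one_ne_zero (by linear_combination -h4)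
  have e2 : q.imJ = 0 := aux 1 _ one_ne_zero (by linear_combination h3)
  have e3 : q.imK = 0 := aux a _ ha (by linear_combination h1)
  exact Algebra.mem_bot.2 ⟨q.re, by ext <;> simp [e1, e2, e3]⟩

theorem QuaternionAlgebra.isSimpleRing_of_ne_zero (h2 : (2 : K) ≠ 0) (ha : a ≠ 0) (hb : b ≠ 0) :
    IsSimpleRing ℍ[K,a,b] := by
  have key : ∀ (I : TwoSidedIdeal ℍ[K,a,b]) (q : ℍ[K,a,b]), q ∈ I → q.re ≠ 0 → I = ⊤ := by
    intro I q hq hw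
    let i : ℍ[K,a,b] := ⟨0, 1, 0, 0⟩
    let j : ℍ[K,a,b] := ⟨0, 0, 1, 0⟩
    let k : ℍ[K,a,b] := ⟨0, 0, 0, 1⟩
    have m : ∀ (c : K) (x : ℍ[K,a,b]), (c : ℍ[K,a,b]) * (x * q * x) ∈ I := fun c x =>
      I.mul_mem_left _ _ (I.mul_mem_right _ _ (I.mul_mem_left _ _ hq))
    have hs := I.mul_mem_left ((4 * q.re)⁻¹ : K) _
      (I.add_mem (I.add_mem (I.add_mem hq (m a⁻¹ i)) (m b⁻¹ j)) (m (-(a * b)⁻¹) k))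
    have h4 : (4 : K) ≠ 0 := by
      have : (4 : K) = 2 * 2 := by norm_num
      rw [this]; exact mul_ne_zero h2 h2
    rw [← TwoSidedIdeal.one_mem_iff]
    convert hs using 1
    ext
    · simp [i, j, k]
      field_simp
      ring
    all_goals
      simp [i, j, k]
      field_simp
      simp
  refine ⟨{ exists_pair_ne := ⟨⊥, ⊤, bot_ne_top⟩, eq_bot_or_eq_top := fun I => ?_ }⟩
  by_contra! hI
  refine hI.1 (bot_unique fun q hq => ?_)
  have z : ∀ p : ℍ[K,a,b], p ∈ I → p.re = 0 := fun p hp => by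
    by_contra hw
    exact hI.2 (key I p hp hw)
  have h0 := z q hq
  have h1 := z _ (I.mul_mem_left ⟨0, 1, 0, 0⟩ _ hq)
  have h3 := z _ (I.mul_mem_left ⟨0, 0, 1, 0⟩ _ hq)
  have h4 := z _ (I.mul_mem_left ⟨0, 0, 0, 1⟩ _ hq)
  simp [ha, hb] at h1 h3 h4
  rw [TwoSidedIdeal.mem_bot]
  ext <;> simp [h0, h1, h3, h4]

/-- The quaternion algebra `(a, b)_{2,K}`, with basis `1, u, v, uv` and `u² = a`, `v² = b`,
`uv = -vu`, as a central simple `K`-algebra, for nonzero `a`, `b` and `char K ≠ 2`. -/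
def quaternionCSA (h2 : (2 : K) ≠ 0) (ha : a ≠ 0) (hb : b ≠ 0) : CSA.{u, u} K where
  toAlgCat := AlgCat.of K ℍ[K,a,b]
  isCentral := QuaternionAlgebra.isCentral_of_ne_zero h2 ha
  isSimple := QuaternionAlgebra.isSimpleRing_of_ne_zero h2 ha hb
  fin_dim := inferInstanceAs (Module.Finite K ℍ[K,a,b])

/-- The Hilbert symbol: the similarity class of `(a, b)_{2,K}` in the Brauer group `Br(K)`. -/
def hilbertSymbol (h2 : (2 : K) ≠ 0) (ha : a ≠ 0) (hb : b ≠ 0) : BrauerGroup.{u, u} K :=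
  Quotient.mk (Brauer.CSA_Setoid K) (quaternionCSA h2 ha hb)

/-- The zero element of `Br(K)`: the class of `K` itself. -/
def brauerZero (K : Type u) [Field K] : BrauerGroup.{u, u} K :=
  Quotient.mk (Brauer.CSA_Setoid K) { toAlgCat := AlgCat.of K K
                                      isCentral := inferInstanceAs (Algebra.IsCentral K K)
                                      isSimple := inferInstanceAs (IsSimpleRing K)
                                      fin_dim := inferInstanceAs (Module.Finite K K) }

end Quaternion

/-- `a` and `b` are nonzero elements of the field `K` of characteristic different from `2`, and
`(a, b)_{2,K} = 0` in `Br(K)`. -/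
def HilbertSymbolEqZero (K : Type u) [Field K] (a b : K) : Prop :=
  ∃ (h2 : (2 : K) ≠ 0) (ha : a ≠ 0) (hb : b ≠ 0), hilbertSymbol h2 ha hb = brauerZero K

/-- The field `k(√D)`, inside an algebraic closure of `k`. It is `k` itself (i.e. `⊥`) if `D` is a
square in `k`. -/
noncomputable def sqrtField (k : Type u) [Field k] (D : k) :
    IntermediateField k (AlgebraicClosure k) :=
  IntermediateField.adjoin k {z : AlgebraicClosure k | z ^ 2 = algebraMap k (AlgebraicClosure k) D}

/-! ### The norm form x² - ay². -/

section NormForm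

variable {K : Type u} [Field K] {a b b' : K}

/-! Write N(x, y) = x² - ay². A class (a, f) vanishes exactly when N represents f
(`hilbertSymbolEqZero_iff`), so (v) and (vi) are statements about norms. Rational ⇒ stably rational
⇒ unirational is formal, and over an infinite k unirationality yields a solution in k by
specialization (`exists_point_of_isUnirationalExt`).

Conversely, a solution (α, β, γ, δ) gives a parameter s of the conic. Multiplying t₃ + t₄√a by s +
√a clears the denominator s² - a, itself a norm, and turns the second equation into N(X, Y) = As² +
Bs + C with A = 2cα + d = N(γ, δ). Projection from a k-point at infinity of this quadric proves
rationality (`isRationalExt_of_quadric`).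

The quadratic in s has discriminant 4a(d² - 4bc²), which is why k' enters: if A is a norm over k', a
k-point exists (`exists_point_of_norm_eq_in_quadratic`). Over k' one can write d = e + gb with eg =
c², and then g(d - 2cα) = N(c - gα, gβ). Hence the class of d - 2cα modulo norms does not depend on
the point of the conic (`exists_norm_eq_of_conic_point`). -/

theorem exists_norm_eq_of_isSquare (h2 : (2 : K) ≠ 0) (ha : a ≠ 0) (h : IsSquare a) (b : K) :
    ∃ x y : K, x ^ 2 - a * y ^ 2 = b := by
  obtain ⟨e, rfl⟩ := h
  have he : e ≠ 0 := fun h => ha (by simp [h])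
  -- Solution of x + ey = b, x - ey = 1.
  exact ⟨(b + 1) / 2, (b - 1) / (2 * e), by field_simp; ring⟩

theorem eq_zero_of_norm_eq_zero (ha : ¬ IsSquare a) {x y : K} (h : x ^ 2 - a * y ^ 2 = 0) :
    x = 0 ∧ y = 0 := by
  have hy : y = 0 := by
    by_contra hy
    exact ha ⟨x / y, by field_simp; linear_combination -h⟩
  subst hy
  exact ⟨by simpa using h, rfl⟩

theorem exists_norm_eq_mul (h : ∃ x y : K, x ^ 2 - a * y ^ 2 = b)
    (h' : ∃ x y : K, x ^ 2 - a * y ^ 2 = b') : ∃ x y : K, x ^ 2 - a * y ^ 2 = b * b' := by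
  obtain ⟨x, y, rfl⟩ := h
  obtain ⟨x', y', rfl⟩ := h'
  exact ⟨x * x' + a * y * y', x * y' + y * x', by ring⟩

theorem exists_norm_eq_inv (h : ∃ x y : K, x ^ 2 - a * y ^ 2 = b) :
    ∃ x y : K, x ^ 2 - a * y ^ 2 = b⁻¹ := by
  by_cases hb : b = 0
  · exact ⟨0, 0, by simp [hb]⟩
  obtain ⟨x, y, rfl⟩ := h
  exact ⟨x / (x ^ 2 - a * y ^ 2), y / (x ^ 2 - a * y ^ 2), by field_simp⟩

theorem exists_norm_eq_of_mul (hb : b ≠ 0) (h : ∃ x y : K, x ^ 2 - a * y ^ 2 = b)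
    (h' : ∃ x y : K, x ^ 2 - a * y ^ 2 = b * b') : ∃ x y : K, x ^ 2 - a * y ^ 2 = b' := by
  have := exists_norm_eq_mul (exists_norm_eq_inv h) h'
  rwa [inv_mul_cancel_left₀ hb] at this

end NormForm

/-! ### Splitting of quaternion algebras. -/

section HilbertSymbol

variable {K : Type u} [Field K] {a b : K}

theorem exists_norm_eq_of_normSq_eq_zero (h2 : (2 : K) ≠ 0) (ha : a ≠ 0) {h : ℍ[K,a,b]}
    (h0 : h ≠ 0) (hh : h.re ^ 2 - a * h.imI ^ 2 = b * (h.imJ ^ 2 - a * h.imK ^ 2)) :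
    ∃ x y : K, x ^ 2 - a * y ^ 2 = b := by
  by_cases hsq : IsSquare a
  · exact exists_norm_eq_of_isSquare h2 ha hsq b
  have hN : h.imJ ^ 2 - a * h.imK ^ 2 ≠ 0 := by
    intro hN
    rw [hN, mul_zero] at hh
    obtain ⟨h3, h4⟩ := eq_zero_of_norm_eq_zero hsq hN
    obtain ⟨h5, h6⟩ := eq_zero_of_norm_eq_zero hsq hh
    exact h0 (QuaternionAlgebra.ext h5 h6 h3 h4)
  exact exists_norm_eq_of_mul hN ⟨_, _, rfl⟩ ⟨_, _, hh.trans (mul_comm _ _)⟩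

/-- A zero divisor of the quaternion algebra has norm zero. -/
theorem QuaternionAlgebra.normSq_eq_zero_of_mul_eq_zero {h e : ℍ[K,a,b]} (he : e ≠ 0)
    (hhe : h * e = 0) : h.re ^ 2 - a * h.imI ^ 2 = b * (h.imJ ^ 2 - a * h.imK ^ 2) := by
  obtain ⟨N, hN⟩ : ∃ N, N = h.re ^ 2 - a * h.imI ^ 2 - b * (h.imJ ^ 2 - a * h.imK ^ 2) := ⟨_, rfl⟩
  have h1 : star h * h = (N : ℍ[K,a,b]) := by
    ext <;> simp <;> (try rw [hN]) <;> ring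
  have h3 : N • e = 0 := by
    rw [← QuaternionAlgebra.coe_mul_eq_smul, ← h1, mul_assoc, hhe, mul_zero]
  exact sub_eq_zero.1 (hN.symm.trans ((smul_eq_zero.1 h3).resolve_right he))

/-- Transporting a rank-one idempotent through Mₙ(ℍ) ≅ Mₘ(K) produces a zero divisor of ℍ, whose
norm vanishes; this avoids Wedderburn uniqueness. -/
theorem exists_norm_eq_of_hilbertSymbol_eq_zero (h2 : (2 : K) ≠ 0) (ha : a ≠ 0) (hb : b ≠ 0)
    (h : hilbertSymbol h2 ha hb = brauerZero K) : ∃ x y : K, x ^ 2 - a * y ^ 2 = b := by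
  obtain ⟨n, m, hn, hm, ⟨φ⟩⟩ : IsBrauerEquivalent _ _ := Quotient.exact h
  change Matrix (Fin n) (Fin n) ℍ[K,a,b] ≃ₐ[K] Matrix (Fin m) (Fin m) K at φ
  have hdim : n * n * 4 = m * m := by
    have := φ.toLinearEquiv.finrank_eq
    simpa [Module.finrank_matrix, QuaternionAlgebra.finrank_eq_four] using this
  have hmn : m = 2 * n := by
    have : m ^ 2 = (2 * n) ^ 2 := by linarith
    exact Nat.pow_left_injective (n := 2) (by norm_num) this
  let j : Fin m := ⟨0, Nat.pos_of_ne_zero hm⟩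
  let E : Matrix (Fin n) (Fin n) ℍ[K,a,b] := φ.symm (Matrix.single j j 1)
  have hE : E ≠ 0 := by
    intro h0
    have h1 : (Matrix.single j j (1 : K)) = 0 := by
      rw [← φ.apply_symm_apply (Matrix.single j j 1)]
      exact (congrArg φ h0).trans (map_zero φ)
    simpa using congrFun (congrFun h1 j) j
  obtain ⟨i, l, hil⟩ : ∃ i l, E i l ≠ 0 := by
    by_contra! h0
    exact hE (Matrix.ext h0)
  let T : (Fin n → ℍ[K,a,b]) →ₗ[K] Matrix (Fin n) (Fin n) ℍ[K,a,b] :=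
    { toFun := fun x => Matrix.of fun r s => if s = i then x r else 0
      map_add' := fun x y => by refine Matrix.ext fun r s => ?_; by_cases hs : s = i <;> simp [hs]
      map_smul' := fun t x => by refine Matrix.ext fun r s => ?_; by_cases hs : s = i <;> simp [hs] }
  let ψ : (Fin n → ℍ[K,a,b]) →ₗ[K] (Fin m → K) :=
    { toFun := fun x r => φ (T x) r j
      map_add' := fun x y => by ext r; simp
      map_smul' := fun t x => by ext r; simp }
  -- The source has dimension 4n and the target m = 2n. A kernel element makes column j of `φ (T x)`
  -- vanish, so `T x` annihilates `E`.
  obtain ⟨x, hx, hx0⟩ : ∃ x ∈ LinearMap.ker ψ, x ≠ 0 := by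
    refine (Submodule.ne_bot_iff _).1 (LinearMap.ker_ne_bot_of_finrank_lt ?_)
    simp [Module.finrank_pi_fintype, QuaternionAlgebra.finrank_eq_four]
    omega
  obtain ⟨r, hr⟩ : ∃ r, x r ≠ 0 := Function.ne_iff.1 hx0
  have hTE : T x * E = 0 := by
    apply φ.injective
    rw [map_mul, φ.apply_symm_apply, map_zero]
    ext r' s
    by_cases hs : s = j
    · subst hs
      simp only [Matrix.mul_single_apply_same, mul_one]
      exact congrFun (LinearMap.mem_ker.1 hx) r'
    · simp [Matrix.mul_apply, Ne.symm hs]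
  have hre : x r * E i l = 0 := by
    have := congrFun (congrFun hTE r) l
    simpa [Matrix.mul_apply, T] using this
  exact exists_norm_eq_of_normSq_eq_zero h2 ha hr
    (QuaternionAlgebra.normSq_eq_zero_of_mul_eq_zero hil hre)

/-- The quaternion algebra `(a, x² - ay²)` is split. -/
def QuaternionAlgebra.matrixBasis (x y : K) (h : x ^ 2 - a * y ^ 2 = b) :
    QuaternionAlgebra.Basis (Matrix (Fin 2) (Fin 2) K) a 0 b where
  -- On K[√a] with basis 1, √a: `i` is multiplication by √a, and `j` is conjugation followed by
  -- multiplication by x + y√a.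
  i := !![0, a; 1, 0]
  j := !![x, -a * y; y, -x]
  k := !![a * y, -a * x; x, -a * y]
  i_mul_i := by
    ext i j; fin_cases i <;> fin_cases j <;> simp
  j_mul_j := by
    subst h
    ext i j; fin_cases i <;> fin_cases j <;> simp <;> ring
  i_mul_j := by
    ext i j; fin_cases i <;> fin_cases j <;> simp
  j_mul_i := by
    ext i j; fin_cases i <;> fin_cases j <;> simp <;> ring

theorem hilbertSymbol_eq_zero_of_norm_eq (h2 : (2 : K) ≠ 0) (ha : a ≠ 0) (hb : b ≠ 0)
    (h : ∃ x y : K, x ^ 2 - a * y ^ 2 = b) : hilbertSymbol h2 ha hb = brauerZero K := by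
  obtain ⟨x, y, h⟩ := h
  have := QuaternionAlgebra.isSimpleRing_of_ne_zero h2 ha hb
  let f : ℍ[K,a,b] →ₐ[K] Matrix (Fin 2) (Fin 2) K :=
    (QuaternionAlgebra.matrixBasis x y h).liftHom
  have hinj : Function.Injective f := f.toRingHom.injective
  have hbij : Function.Bijective f :=
    ⟨hinj, (LinearMap.injective_iff_surjective_of_finrank_eq_finrank (f := f.toLinearMap)
      (by simp [Module.finrank_matrix, QuaternionAlgebra.finrank_eq_four])).1 hinj⟩
  let g : Matrix (Fin 1) (Fin 1) ℍ[K,a,b] ≃ₐ[K] ℍ[K,a,b] := by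
    convert Matrix.uniqueAlgEquiv (m := Fin 1) (A := ℍ[K,a,b]) (R := K)
  exact Quotient.sound ⟨1, 2, one_ne_zero, two_ne_zero,
    ⟨g.trans (AlgEquiv.ofBijective f hbij)⟩⟩

theorem hilbertSymbolEqZero_iff (h2 : (2 : K) ≠ 0) (ha : a ≠ 0) (hb : b ≠ 0) :
    HilbertSymbolEqZero K a b ↔ ∃ x y : K, x ^ 2 - a * y ^ 2 = b :=
  ⟨fun ⟨_, _, _, h⟩ => exists_norm_eq_of_hilbertSymbol_eq_zero h2 ha hb h,
    fun h => ⟨h2, ha, hb, hilbertSymbol_eq_zero_of_norm_eq h2 ha hb h⟩⟩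

end HilbertSymbol

/-! ### Rational, stably rational and unirational extensions. -/

section Rationality

variable {k : Type u} {L : Type v} [Field k] [Field L] [Algebra k L]

theorem IsRationalExt.isStablyRationalExt (h : IsRationalExt k L) : IsStablyRationalExt k L := by
  obtain ⟨n, ⟨e⟩⟩ := h
  let g : L ≃ₐ[k] MvPolynomial (Fin 0) L := (MvPolynomial.isEmptyAlgEquiv L (Fin 0)).symm.restrictScalars k
  have hg : Function.Bijective (algebraMap (MvPolynomial (Fin 0) L)
      (FractionRing (MvPolynomial (Fin 0) L))) :=
    IsField.localization_map_bijective (M := nonZeroDivisors (MvPolynomial (Fin 0) L)) (by simp)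
      (g.symm.toMulEquiv.isField (Field.toIsField L))
  let f := AlgEquiv.ofBijective
    (IsScalarTower.toAlgHom k (MvPolynomial (Fin 0) L) (FractionRing (MvPolynomial (Fin 0) L))) hg
  exact ⟨0, n, ⟨(g.trans f).symm.trans e⟩⟩

theorem IsStablyRationalExt.isUnirationalExt (h : IsStablyRationalExt k L) :
    IsUnirationalExt k L := by
  obtain ⟨m, n, ⟨e⟩⟩ := h
  exact ⟨n, ⟨e.toAlgHom.comp (IsScalarTower.toAlgHom k L (FractionRing (MvPolynomial (Fin m) L)))⟩⟩

/-- Finitely many elements of a rational function field over an infinite field can be evaluated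
at a common point: they have a common denominator which does not vanish there. -/
theorem exists_common_denominator_eval_ne_zero [Infinite k] {n : ℕ} {ι : Type*} [Finite ι]
    (t : ι → FractionRing (MvPolynomial (Fin n) k)) :
    ∃ (g : MvPolynomial (Fin n) k) (f : ι → MvPolynomial (Fin n) k) (x : Fin n → k),
      (∀ i, algebraMap _ _ g * t i = algebraMap _ _ (f i)) ∧ MvPolynomial.eval x g ≠ 0 := by
  obtain ⟨g, hg⟩ := IsLocalization.exist_integer_multiples_of_finite
    (nonZeroDivisors (MvPolynomial (Fin n) k)) t
  choose f hf using hg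
  have hg0 : (g : MvPolynomial (Fin n) k) ≠ 0 := nonZeroDivisors.ne_zero g.2
  obtain ⟨x, hx⟩ : ∃ x, MvPolynomial.eval x (g : MvPolynomial (Fin n) k) ≠ 0 := by
    by_contra! h
    exact hg0 (MvPolynomial.funext fun x => by simpa using h x)
  refine ⟨g, f, x, fun i => ?_, hx⟩
  rw [hf i, Algebra.smul_def]

/-- If `L` is algebraic over `k(x)`, then its transcendence degree over `k` is at most one. -/
theorem trdeg_le_one_of_isAlgebraic_adjoin {S : Set L} (hS : IntermediateField.adjoin k S = ⊤)
    (x : L) (h : ∀ y ∈ S, IsAlgebraic (Algebra.adjoin k {x}) y) : Algebra.trdeg k L ≤ 1 := by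
  have : Algebra.IsAlgebraic (Algebra.adjoin k {x}) L := by
    refine ⟨fun y => ?_⟩
    have hy : y ∈ IntermediateField.adjoin k S := hS ▸ IntermediateField.mem_top
    induction hy using IntermediateField.adjoin_induction with
    | mem y hy => exact h y hy
    | algebraMap r => exact isAlgebraic_algebraMap (algebraMap k (Algebra.adjoin k {x}) r)
    | add y z _ _ hy hz => exact hy.add hz
    | inv y _ hy => exact hy.inv
    | mul y z _ _ hy hz => exact hy.mul hz
  simpa using Algebra.IsAlgebraic.trdeg_le_cardinalMk k ({x} : Set L)

theorem isRationalExt_of_adjoin_pair_eq_top (p q : L)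
    (h : IntermediateField.adjoin k {p, q} = ⊤) (htr : Algebra.trdeg k L = 2) :
    IsRationalExt k L := by
  have hr : Set.range ![p, q] = {p, q} := by simp [Set.pair_comm]
  have : Algebra.IsAlgebraic (Algebra.adjoin k (Set.range ![p, q])) L := by
    refine ⟨fun y => ?_⟩
    have hy : y ∈ IntermediateField.adjoin k {p, q} := h ▸ IntermediateField.mem_top
    rw [← hr] at hy
    induction hy using IntermediateField.adjoin_induction with
    | mem y hy =>
      exact isAlgebraic_algebraMap
        (⟨y, Algebra.subset_adjoin hy⟩ : Algebra.adjoin k (Set.range ![p, q]))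
    | algebraMap r =>
      exact isAlgebraic_algebraMap (algebraMap k (Algebra.adjoin k (Set.range ![p, q])) r)
    | add y z _ _ hy hz => exact hy.add hz
    | inv y _ hy => exact hy.inv
    | mul y z _ _ hy hz => exact hy.mul hz
  have hb := Algebra.IsAlgebraic.isTranscendenceBasis_of_lift_le_trdeg_of_finite k ![p, q]
    (by simp [htr])
  refine ⟨2, ⟨(hb.1.aevalEquivField.trans ?_).symm⟩⟩
  exact (IntermediateField.equivOfEq (by rw [hr, h])).trans IntermediateField.topEquiv

end Rationality

/-! ### Rationality of the surface with a k-point. -/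

section Surface

variable {k : Type u} {L : Type v} [Field k] [Field L] [Algebra k L] {a b c d : k}

theorem exists_point_of_isUnirationalExt [Infinite k] (t₁ t₂ t₃ t₄ : L)
    (hrel₁ : t₁ ^ 2 - algebraMap k L a * t₂ ^ 2 = algebraMap k L b)
    (hrel₂ : t₃ ^ 2 - algebraMap k L a * t₄ ^ 2 =
      2 * algebraMap k L c * t₁ + algebraMap k L d)
    (h : IsUnirationalExt k L) :
    ∃ α β γ δ : k, α ^ 2 - a * β ^ 2 = b ∧ γ ^ 2 - a * δ ^ 2 = 2 * c * α + d := by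
  obtain ⟨n, ⟨φ⟩⟩ := h
  obtain ⟨g, f, x, hf, hx⟩ := exists_common_denominator_eval_ne_zero
    ![φ t₁, φ t₂, φ t₃, φ t₄]
  have h1 := hf 0
  have h2 := hf 1
  have h3 := hf 2
  have h4 := hf 3
  simp only [Matrix.cons_val] at h1 h2 h3 h4
  have hinj := IsFractionRing.injective (MvPolynomial (Fin n) k)
    (FractionRing (MvPolynomial (Fin n) k))
  have halg : ∀ r : k, algebraMap k (FractionRing (MvPolynomial (Fin n) k)) r =
      algebraMap _ _ (MvPolynomial.C r) := fun r =>
    IsScalarTower.algebraMap_apply k (MvPolynomial (Fin n) k) _ r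
  have e1 := congrArg φ hrel₁
  have e2 := congrArg φ hrel₂
  simp only [map_sub, map_mul, map_add, map_pow, AlgHom.commutes, halg, map_ofNat] at e1 e2
  have p1 : f 0 ^ 2 - MvPolynomial.C a * f 1 ^ 2 = MvPolynomial.C b * g ^ 2 := by
    apply hinj
    simp only [map_sub, map_mul, map_pow, ← h1, ← h2]
    linear_combination (algebraMap _ _ g) ^ 2 * e1
  have p2 : f 2 ^ 2 - MvPolynomial.C a * f 3 ^ 2 =
      2 * MvPolynomial.C c * f 0 * g + MvPolynomial.C d * g ^ 2 := by
    apply hinj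
    simp only [map_sub, map_mul, map_pow, map_add, map_ofNat, ← h1, ← h3, ← h4]
    linear_combination (algebraMap _ _ g) ^ 2 * e2
  have q1 := congrArg (MvPolynomial.eval x) p1
  have q2 := congrArg (MvPolynomial.eval x) p2
  simp only [map_sub, map_mul, map_add, map_pow, MvPolynomial.eval_C, map_ofNat] at q1 q2
  refine ⟨MvPolynomial.eval x (f 0) / MvPolynomial.eval x g,
    MvPolynomial.eval x (f 1) / MvPolynomial.eval x g,
    MvPolynomial.eval x (f 2) / MvPolynomial.eval x g,
    MvPolynomial.eval x (f 3) / MvPolynomial.eval x g, ?_, ?_⟩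
  · field_simp
    linear_combination q1
  · field_simp
    linear_combination q2

/-- With t₁, t₂ constant, t₃ is algebraic over k(t₄), which leaves too small a transcendence degree.
-/
theorem not_constant_of_trdeg_eq_two (t₁ t₂ t₃ t₄ : L)
    (hgen : IntermediateField.adjoin k {t₁, t₂, t₃, t₄} = ⊤)
    (htrdeg : Algebra.trdeg k L = 2)
    (hrel₂ : t₃ ^ 2 - algebraMap k L a * t₄ ^ 2 =
      2 * algebraMap k L c * t₁ + algebraMap k L d) {α β : k}
    (h1 : t₁ = algebraMap k L α) (h2 : t₂ = algebraMap k L β) : False := by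
  have halg : ∀ r : k, IsAlgebraic (Algebra.adjoin k {t₄}) (algebraMap k L r) := fun r =>
    isAlgebraic_algebraMap (algebraMap k (Algebra.adjoin k {t₄}) r)
  have h4 : IsAlgebraic (Algebra.adjoin k {t₄}) t₄ :=
    isAlgebraic_algebraMap (⟨t₄, Algebra.subset_adjoin rfl⟩ : Algebra.adjoin k {t₄})
  have h3 : IsAlgebraic (Algebra.adjoin k {t₄}) t₃ := by
    refine IsAlgebraic.of_pow two_pos ?_
    have : t₃ ^ 2 = algebraMap k L (2 * c * α + d) + algebraMap k L a * t₄ ^ 2 := by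
      simp only [map_add, map_mul, map_ofNat, ← h1]
      linear_combination hrel₂
    rw [this]
    exact (halg _).add ((halg _).mul (h4.pow 2))
  have := trdeg_le_one_of_isAlgebraic_adjoin hgen t₄ (by
    simp only [Set.mem_insert_iff, Set.mem_singleton_iff]
    rintro y (rfl | rfl | rfl | rfl)
    · exact h1 ▸ halg α
    · exact h2 ▸ halg β
    · exact h3
    · exact h4)
  rw [htrdeg] at this
  norm_num at this

/-- The quadric `X² - aY² = (γ² - aδ²)s² + Bs + C` is rational, by projection from the point at
infinity `(γ : δ : 1 : 0)`. -/
theorem isRationalExt_of_quadric (h2 : (2 : k) ≠ 0) (ha : ¬ IsSquare a) {γ δ B C : k} (s X Y : L)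
    (hAB : γ ^ 2 - a * δ ^ 2 = 0 → B ≠ 0)
    (hgen : IntermediateField.adjoin k {s, X, Y} = ⊤)
    (htrdeg : Algebra.trdeg k L = 2)
    (hrel : X ^ 2 - algebraMap k L a * Y ^ 2 =
      algebraMap k L (γ ^ 2 - a * δ ^ 2) * s ^ 2 + algebraMap k L B * s + algebraMap k L C) :
    IsRationalExt k L := by
  have ha0 : algebraMap k L a ≠ 0 := by
    rw [map_ne_zero]
    rintro rfl
    exact ha IsSquare.zero
  simp only [map_sub, map_mul, map_pow] at hrel
  have hmem : ∀ F : IntermediateField k L, s ∈ F → X - algebraMap k L γ * s ∈ F →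
      Y - algebraMap k L δ * s ∈ F → F = ⊤ := by
    intro F hs hX hY
    rw [eq_top_iff, ← hgen, IntermediateField.adjoin_le_iff]
    rintro y (rfl | rfl | rfl)
    · exact hs
    · simpa using F.add_mem hX (F.mul_mem (F.algebraMap_mem γ) hs)
    · simpa using F.add_mem hY (F.mul_mem (F.algebraMap_mem δ) hs)
  obtain ⟨p, hp⟩ : ∃ p, p = X - algebraMap k L γ * s := ⟨_, rfl⟩
  obtain ⟨q, hq⟩ : ∃ q, q = Y - algebraMap k L δ * s := ⟨_, rfl⟩
  rw [← hp, ← hq] at hmem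
  obtain rfl : X = p + algebraMap k L γ * s := by rw [hp]; ring
  obtain rfl : Y = q + algebraMap k L δ * s := by rw [hq]; ring
  clear hp hq
  -- In terms of p and q the s² terms cancel, so the equation is linear in s; equality here means
  -- that the coefficient of s vanishes.
  by_cases hm : 2 * (algebraMap k L γ * p - algebraMap k L a * algebraMap k L δ * q) =
      algebraMap k L B
  · exfalso
    have hA : γ ^ 2 - a * δ ^ 2 ≠ 0 := by
      intro h0
      obtain ⟨rfl, rfl⟩ := eq_zero_of_norm_eq_zero ha h0
      exact hAB h0 (by simpa using hm.symm)
    have hA' : algebraMap k L γ ^ 2 - algebraMap k L a * algebraMap k L δ ^ 2 ≠ 0 := by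
      have := (map_ne_zero (algebraMap k L)).2 hA
      simpa using this
    have h2' : (2 : L) ≠ 0 := map_ofNat (algebraMap k L) 2 ▸ (map_ne_zero _).2 h2
    have halg : ∀ r : k, IsAlgebraic (Algebra.adjoin k {s}) (algebraMap k L r) := fun r =>
      isAlgebraic_algebraMap (algebraMap k (Algebra.adjoin k {s}) r)
    have hs : IsAlgebraic (Algebra.adjoin k {s}) s :=
      isAlgebraic_algebraMap (⟨s, Algebra.subset_adjoin rfl⟩ : Algebra.adjoin k {s})
    -- From γp - aδq = B/2 and p² - aq² = C, multiplicativity of the norm makes (γq - δp)² a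
    -- constant. Then p and q are algebraic too, which contradicts transcendence degree 2.
    have hn : IsAlgebraic (Algebra.adjoin k {s}) (algebraMap k L γ * q - algebraMap k L δ * p) := by
      refine IsAlgebraic.of_pow two_pos ?_
      have : (algebraMap k L γ * q - algebraMap k L δ * p) ^ 2 =
          algebraMap k L (((B / 2) ^ 2 - (γ ^ 2 - a * δ ^ 2) * C) / a) := by
        simp only [map_sub, map_mul, map_pow, map_div₀, map_ofNat, ← hm]
        field_simp
        linear_combination (-(algebraMap k L γ ^ 2 - algebraMap k L a * algebraMap k L δ ^ 2)) *
          hrel + (algebraMap k L γ ^ 2 - algebraMap k L a * algebraMap k L δ ^ 2) * s * hm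
      rw [this]
      exact halg _
    have hpn : p = algebraMap k L (γ * (B / 2) / (γ ^ 2 - a * δ ^ 2)) +
        algebraMap k L (a * δ / (γ ^ 2 - a * δ ^ 2)) *
          (algebraMap k L γ * q - algebraMap k L δ * p) := by
      simp only [map_sub, map_mul, map_pow, map_div₀, map_ofNat, ← hm]
      field_simp
      ring
    have hqn : q = algebraMap k L (δ * (B / 2) / (γ ^ 2 - a * δ ^ 2)) +
        algebraMap k L (γ / (γ ^ 2 - a * δ ^ 2)) *
          (algebraMap k L γ * q - algebraMap k L δ * p) := by
      simp only [map_sub, map_mul, map_pow, map_div₀, map_ofNat, ← hm]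
      rw [mul_div_cancel_left₀ _ h2', div_mul_eq_mul_div, ← add_div, eq_div_iff hA']
      ring
    have hp : IsAlgebraic (Algebra.adjoin k {s}) p := by
      rw [hpn]
      exact (halg _).add ((halg _).mul hn)
    have hq : IsAlgebraic (Algebra.adjoin k {s}) q := by
      rw [hqn]
      exact (halg _).add ((halg _).mul hn)
    have := trdeg_le_one_of_isAlgebraic_adjoin hgen s (by
      simp only [Set.mem_insert_iff, Set.mem_singleton_iff]
      rintro y (rfl | rfl | rfl)
      · exact hs
      · exact hp.add ((halg _).mul hs)
      · exact hq.add ((halg _).mul hs))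
    rw [htrdeg] at this
    norm_num at this
  · refine isRationalExt_of_adjoin_pair_eq_top p q ?_ htrdeg
    have hpF : p ∈ IntermediateField.adjoin k {p, q} :=
      IntermediateField.subset_adjoin k _ (by simp)
    have hqF : q ∈ IntermediateField.adjoin k {p, q} :=
      IntermediateField.subset_adjoin k _ (by simp)
    refine hmem _ ?_ hpF hqF
    have hs : s = (algebraMap k L C - p ^ 2 + algebraMap k L a * q ^ 2) /
        (2 * (algebraMap k L γ * p - algebraMap k L a * algebraMap k L δ * q) -
          algebraMap k L B) := by
      rw [eq_div_iff (sub_ne_zero.2 hm)]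
      linear_combination hrel
    rw [hs]
    have hc : ∀ r : k, algebraMap k L r ∈ IntermediateField.adjoin k {p, q} :=
      fun r => IntermediateField.algebraMap_mem _ r
    have h2 : (2 : L) ∈ IntermediateField.adjoin k {p, q} := by simpa only [map_ofNat] using hc 2
    exact div_mem (add_mem (sub_mem (hc _) (pow_mem hpF _)) (mul_mem (hc _) (pow_mem hqF _)))
      (sub_mem (mul_mem h2 (sub_mem (mul_mem (hc _) hpF) (mul_mem (mul_mem (hc _) (hc _)) hqF)))
        (hc _))

theorem isRationalExt_of_point (h2 : (2 : k) ≠ 0)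
    (ha : ¬ IsSquare a) (hb : ¬ IsSquare b) (hcd : c ≠ 0 ∨ d ≠ 0) (t₁ t₂ t₃ t₄ : L)
    (hgen : IntermediateField.adjoin k {t₁, t₂, t₃, t₄} = ⊤)
    (htrdeg : Algebra.trdeg k L = 2)
    (hrel₁ : t₁ ^ 2 - algebraMap k L a * t₂ ^ 2 = algebraMap k L b)
    (hrel₂ : t₃ ^ 2 - algebraMap k L a * t₄ ^ 2 =
      2 * algebraMap k L c * t₁ + algebraMap k L d) {α β γ δ : k}
    (hαβ : α ^ 2 - a * β ^ 2 = b) (hγδ : γ ^ 2 - a * δ ^ 2 = 2 * c * α + d) :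
    IsRationalExt k L := by
  have ha0 : a ≠ 0 := fun h => ha (h ▸ IsSquare.zero)
  have hb0 : b ≠ 0 := fun h => hb (h ▸ IsSquare.zero)
  have ha0' : algebraMap k L a ≠ 0 := by simpa using ha0
  have hb0' : algebraMap k L b ≠ 0 := by simpa using hb0
  have h2' : (2 : L) ≠ 0 := map_ofNat (algebraMap k L) 2 ▸ (map_ne_zero _).2 h2
  have hαβ' : algebraMap k L α ^ 2 - algebraMap k L a * algebraMap k L β ^ 2 =
      algebraMap k L b := by simp [← hαβ]
  have hβ : β ≠ 0 := by
    rintro rfl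
    exact hb ⟨α, by linear_combination -hαβ⟩
  -- u + v√a = (t₁ + t₂√a) / (α + β√a), a point of the norm-one conic.
  obtain ⟨u, hu⟩ : ∃ u, u = (algebraMap k L α * t₁ - algebraMap k L a * algebraMap k L β * t₂) /
    algebraMap k L b := ⟨_, rfl⟩
  obtain ⟨v, hv⟩ : ∃ v, v = (algebraMap k L α * t₂ - algebraMap k L β * t₁) /
    algebraMap k L b := ⟨_, rfl⟩
  have ht₁ : t₁ = algebraMap k L α * u + algebraMap k L a * algebraMap k L β * v := by
    rw [hu, hv]
    field_simp
    linear_combination -t₁ * hαβ'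
  have ht₂ : t₂ = algebraMap k L α * v + algebraMap k L β * u := by
    rw [hu, hv]
    field_simp
    linear_combination -t₂ * hαβ'
  clear hu hv
  have huv : u ^ 2 - algebraMap k L a * v ^ 2 = 1 := by
    refine mul_left_cancel₀ hb0' ?_
    rw [ht₁, ht₂] at hrel₁
    linear_combination hrel₁ - (u ^ 2 - algebraMap k L a * v ^ 2) * hαβ'
  have hu1 : u - 1 ≠ 0 := by
    intro h
    have hu : u = 1 := sub_eq_zero.1 h
    have hv : v = 0 := by simpa [hu, ha0] using huv
    exact not_constant_of_trdeg_eq_two t₁ t₂ t₃ t₄ hgen htrdeg hrel₂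
      (α := α) (β := β) (by rw [ht₁, hu, hv]; ring) (by rw [ht₂, hu, hv]; ring)
  -- Lines through (1, 0) parametrize that conic: u + v√a = (s + √a) / (s - √a).
  obtain ⟨s, hs⟩ : ∃ s, s = algebraMap k L a * v / (u - 1) := ⟨_, rfl⟩
  have hsa : s ^ 2 - algebraMap k L a = 2 * algebraMap k L a / (u - 1) := by
    rw [hs]
    field_simp
    linear_combination -huv
  have hsa0 : s ^ 2 - algebraMap k L a ≠ 0 := by
    rw [hsa]
    exact div_ne_zero (mul_ne_zero h2' ha0') hu1
  have hus : u = (s ^ 2 + algebraMap k L a) / (s ^ 2 - algebraMap k L a) := by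
    rw [eq_div_iff hsa0, show s ^ 2 + algebraMap k L a =
      (s ^ 2 - algebraMap k L a) + 2 * algebraMap k L a by ring, hsa]
    field_simp
    ring
  have hvs : v = 2 * s / (s ^ 2 - algebraMap k L a) := by
    rw [eq_div_iff hsa0, hsa, hs]
    field_simp
  -- X + Y√a = (t₃ + t₄√a)(s + √a); B and C come from expanding (s² - a)(2ct₁ + d).
  refine isRationalExt_of_quadric h2 ha (γ := γ) (δ := δ) (B := 4 * a * c * β)
    (C := a * (2 * c * α - d)) s (t₃ * s + algebraMap k L a * t₄) (t₃ + t₄ * s) ?_ ?_ htrdeg ?_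
  · intro h0 hB
    have h4 : (4 : k) ≠ 0 := by
      have := mul_ne_zero h2 h2
      norm_num at this
      exact this
    have hc : c = 0 := by simpa [h4, ha0, hβ] using hB
    rw [hγδ, hc] at h0
    exact hcd.elim (fun h => h hc) (fun h => h (by simpa using h0))
  · rw [eq_top_iff, ← hgen, IntermediateField.adjoin_le_iff]
    set F := IntermediateField.adjoin k {s, t₃ * s + algebraMap k L a * t₄, t₃ + t₄ * s} with hF
    have hsF : s ∈ F := IntermediateField.subset_adjoin k _ (by simp)
    have hXF : t₃ * s + algebraMap k L a * t₄ ∈ F := IntermediateField.subset_adjoin k _ (by simp)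
    have hYF : t₃ + t₄ * s ∈ F := IntermediateField.subset_adjoin k _ (by simp)
    have hc : ∀ r : k, algebraMap k L r ∈ F := fun r => F.algebraMap_mem r
    have h2F : (2 : L) ∈ F := by simpa only [map_ofNat] using hc 2
    have hsaF : s ^ 2 - algebraMap k L a ∈ F := sub_mem (pow_mem hsF _) (hc _)
    have huF : u ∈ F := hus ▸ div_mem (add_mem (pow_mem hsF _) (hc _)) hsaF
    have hvF : v ∈ F := hvs ▸ div_mem (mul_mem h2F hsF) hsaF
    rintro y (rfl | rfl | rfl | rfl)
    · exact ht₁ ▸ add_mem (mul_mem (hc _) huF) (mul_mem (mul_mem (hc _) (hc _)) hvF)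
    · exact ht₂ ▸ add_mem (mul_mem (hc _) hvF) (mul_mem (hc _) huF)
    · have : y = ((y * s + algebraMap k L a * t₄) * s - algebraMap k L a * (y + t₄ * s)) /
          (s ^ 2 - algebraMap k L a) := by
        field_simp
        ring
      rw [SetLike.mem_coe, this]
      exact div_mem (sub_mem (mul_mem hXF hsF) (mul_mem (hc _) hYF)) hsaF
    · have : y = ((t₃ + y * s) * s - (t₃ * s + algebraMap k L a * y)) /
          (s ^ 2 - algebraMap k L a) := by
        field_simp
        ring
      rw [SetLike.mem_coe, this]
      exact div_mem (sub_mem (mul_mem hYF hsF) hXF) hsaF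
  · have e : (s ^ 2 - algebraMap k L a) * t₁ = algebraMap k L α * (s ^ 2 + algebraMap k L a) +
        2 * algebraMap k L a * algebraMap k L β * s := by
      rw [ht₁, hus, hvs]
      field_simp
    simp only [hγδ, map_add, map_sub, map_mul, map_ofNat]
    linear_combination (s ^ 2 - algebraMap k L a) * hrel₂ + 2 * algebraMap k L c * e

end Surface

/-! ### Norms from k(√a) and points of the conic. -/

section Conic

variable {k : Type u} [Field k] {a b c d α β : k}

/-- Over a field containing a square root `w` of `d² - 4bc²`, whether `d - 2cα` is a norm from the
extension by `√a` does not depend on the point `(α, β)` of the conic `α² - aβ² = b`. -/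
theorem exists_norm_eq_of_conic_point (h2 : (2 : k) ≠ 0) (ha : a ≠ 0) (hb : b ≠ 0) (hβ : β ≠ 0)
    (hcd : c ≠ 0 ∨ d ≠ 0) {w : k} (hw : w ^ 2 = d ^ 2 - 4 * b * c ^ 2) {α' β' : k}
    (h : α ^ 2 - a * β ^ 2 = b) (h' : α' ^ 2 - a * β' ^ 2 = b)
    (hn : ∃ x y : k, x ^ 2 - a * y ^ 2 = -2 * c * α + d) :
    ∃ x y : k, x ^ 2 - a * y ^ 2 = -2 * c * α' + d := by
  by_cases h0 : -2 * c * α + d = 0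
  · have hc : c ≠ 0 := by
      rintro rfl
      exact hcd.elim (fun h => h rfl) (fun h => h (by simpa using h0))
    -- If d = 2cα then w² = 4c²(α² - b) = 4ac²β², so a is a square and every element is a norm.
    refine exists_norm_eq_of_isSquare h2 ha ⟨w / (2 * c * β), ?_⟩ _
    field_simp
    linear_combination (-4 * c ^ 2) * h - hw - (d + 2 * c * α) * h0
  · refine exists_norm_eq_of_mul h0 hn ?_
    obtain ⟨e, he⟩ : ∃ e, e = (d - w) / 2 := ⟨_, rfl⟩
    obtain ⟨g, hg⟩ : ∃ g, g = (d + w) / (2 * b) := ⟨_, rfl⟩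
    have hd : d = e + g * b := by
      rw [he, hg]
      field_simp
      ring
    have heg : e * g = c ^ 2 := by
      rw [he, hg]
      field_simp
      linear_combination -hw
    -- Put θ = α + β√a and θ' = α' + β'√a. The witness is, up to sign, (c - gθ̄)(c - gθ') / g,
    -- expanded with c²/g replaced by e so that g = 0 is allowed.
    refine ⟨c * (α' + α) - e - g * (α * α' - a * β * β'),
      c * (β' - β) - g * (α * β' - β * α'), ?_⟩
    rw [hd, ← h]
    linear_combination -(2 * (α ^ 2 - a * β ^ 2) - 2 * (α * α' - a * β * β')) * heg -
      (h - h') * (g ^ 2 * (α ^ 2 - a * β ^ 2) - 2 * c * g * α + c ^ 2)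

/-- A point of the surface from a representation of `d² - 4bc²` by the form
`⟨a, 2cα + d, -a(2cα + d)⟩`. -/
theorem exists_point_of_discr_eq (ha : ¬ IsSquare a) (h : α ^ 2 - a * β ^ 2 = b) {p q r : k}
    (hD : d ^ 2 - 4 * b * c ^ 2 = (2 * c * α + d) * (q ^ 2 - a * r ^ 2) + a * p ^ 2) :
    ∃ α' β' γ δ : k, α' ^ 2 - a * β' ^ 2 = b ∧ γ ^ 2 - a * δ ^ 2 = 2 * c * α' + d := by
  by_cases hA : 2 * c * α + d = 0
  · exact ⟨α, β, 0, 0, h, by simp [hA]⟩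
  -- Completing the square, A(As² + Bs + C) = (As + 2acβ)² - aD with A = 2cα + d and D = d² - 4bc².
  -- Setting As + 2acβ = ap turns `hD` into a point (X, Y) = (ar, q) of the quadric. Dividing ar +
  -- q√a by s + √a returns to the surface.
  obtain ⟨s, hs⟩ : ∃ s, (2 * c * α + d) * s = a * p - 2 * a * c * β :=
    ⟨(a * p - 2 * a * c * β) / (2 * c * α + d), mul_div_cancel₀ _ hA⟩
  have hq : (a * r) ^ 2 - a * q ^ 2 =
      (2 * c * α + d) * s ^ 2 + 4 * a * c * β * s + a * (2 * c * α - d) := by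
    refine mul_left_cancel₀ hA ?_
    linear_combination a * hD - ((2 * c * α + d) * s + 2 * a * c * β + a * p) * hs -
      4 * a * c ^ 2 * h
  have hsa : s ^ 2 - a ≠ 0 := fun h0 => ha ⟨s, by linear_combination -h0⟩
  refine ⟨(α * (s ^ 2 + a) + 2 * a * β * s) / (s ^ 2 - a),
    (2 * α * s + β * (s ^ 2 + a)) / (s ^ 2 - a),
    (a * r * s - a * q) / (s ^ 2 - a), (q * s - a * r) / (s ^ 2 - a), ?_, ?_⟩
  · field_simp
    linear_combination (s ^ 2 - a) ^ 2 * h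
  · field_simp
    linear_combination (s ^ 2 - a) * hq

theorem exists_point_of_norm_eq_in_quadratic {E : Type v} [Field E] [Algebra k E]
    (h2 : (2 : k) ≠ 0) (ha : ¬ IsSquare a) (h : α ^ 2 - a * β ^ 2 = b) {w : E}
    (hw : w ^ 2 = algebraMap k E (d ^ 2 - 4 * b * c ^ 2))
    (hspan : ∀ x : E, ∃ x₀ x₁ : k, x = algebraMap k E x₀ + algebraMap k E x₁ * w)
    (hn : ∃ x y : E, x ^ 2 - algebraMap k E a * y ^ 2 = algebraMap k E (2 * c * α + d)) :
    ∃ α' β' γ δ : k, α' ^ 2 - a * β' ^ 2 = b ∧ γ ^ 2 - a * δ ^ 2 = 2 * c * α' + d := by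
  obtain ⟨x, y, hxy⟩ := hn
  have hinj := (algebraMap k E).injective
  by_cases hwk : ∃ e : k, algebraMap k E e = w
  · obtain ⟨e, rfl⟩ := hwk
    obtain ⟨x₀, x₁, rfl⟩ := hspan x
    obtain ⟨y₀, y₁, rfl⟩ := hspan y
    exact ⟨α, β, x₀ + x₁ * e, y₀ + y₁ * e, h, hinj (by simpa using hxy)⟩
  have hli : ∀ u v : k, algebraMap k E u + algebraMap k E v * w = 0 → u = 0 ∧ v = 0 := by
    intro u v huv
    have hv : v = 0 := by
      by_contra hv
      have hv' : algebraMap k E v ≠ 0 := by simpa using hv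
      refine hwk ⟨-u / v, ?_⟩
      rw [map_div₀, map_neg, div_eq_iff hv']
      linear_combination -huv
    exact ⟨by simpa [hv] using huv, hv⟩
  obtain ⟨x₀, x₁, rfl⟩ := hspan x
  obtain ⟨y₀, y₁, rfl⟩ := hspan y
  obtain ⟨h0, h1⟩ := hli
    (x₀ ^ 2 - a * y₀ ^ 2 + (d ^ 2 - 4 * b * c ^ 2) * (x₁ ^ 2 - a * y₁ ^ 2) - (2 * c * α + d))
    (2 * (x₀ * x₁ - a * y₀ * y₁)) (by
      simp only [map_add, map_sub, map_mul, map_pow, map_ofNat] at hw hxy ⊢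
      linear_combination hxy - (algebraMap k E x₁ ^ 2 - algebraMap k E a * algebraMap k E y₁ ^ 2) * hw)
  by_cases hM : x₁ ^ 2 - a * y₁ ^ 2 = 0
  · exact ⟨α, β, x₀, y₀, h, by
      linear_combination h0 - (d ^ 2 - 4 * b * c ^ 2) * hM⟩
  have htr : x₀ * x₁ - a * y₀ * y₁ = 0 := (mul_eq_zero.1 h1).resolve_left h2
  -- With M = N(x₁, y₁), `h0` gives D = (A - N(x₀, y₀)) / M, where 1/M = N(x₁/M, y₁/M). Since x₀x₁ =
  -- ay₀y₁, also N(x₀, y₀)M = -a(x₀y₁ - y₀x₁)².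
  refine exists_point_of_discr_eq ha h (p := (y₀ * x₁ - x₀ * y₁) / (x₁ ^ 2 - a * y₁ ^ 2))
    (q := x₁ / (x₁ ^ 2 - a * y₁ ^ 2)) (r := y₁ / (x₁ ^ 2 - a * y₁ ^ 2)) ?_
  field_simp
  linear_combination (x₁ ^ 2 - a * y₁ ^ 2) * h0 - (x₀ * x₁ - a * y₀ * y₁) * htr

end Conic

/-! ### The field k(√D). -/

section SqrtField

variable {k : Type u} [Field k]

/-- k + k√D is closed under multiplication. Uniqueness of the coordinates is not claimed, so D may
be a square. -/
theorem exists_sqrtField_generator (D : k) :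
    ∃ w : sqrtField k D, w ^ 2 = algebraMap k (sqrtField k D) D ∧
      ∀ x : sqrtField k D, ∃ x₀ x₁ : k,
        x = algebraMap k (sqrtField k D) x₀ + algebraMap k (sqrtField k D) x₁ * w := by
  obtain ⟨s, hs⟩ := IsAlgClosed.exists_pow_nat_eq (algebraMap k (AlgebraicClosure k) D) two_pos
  refine ⟨⟨s, IntermediateField.subset_adjoin k _ hs⟩, Subtype.ext hs, ?_⟩
  rintro ⟨x, hx⟩
  suffices ∃ x₀ x₁ : k, x = algebraMap k (AlgebraicClosure k) x₀ +
      algebraMap k (AlgebraicClosure k) x₁ * s by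
    obtain ⟨x₀, x₁, h⟩ := this
    exact ⟨x₀, x₁, Subtype.ext h⟩
  rw [sqrtField, ← IntermediateField.mem_toSubalgebra,
    IntermediateField.adjoin_toSubalgebra_of_isAlgebraic
      (fun y _ => Algebra.IsAlgebraic.isAlgebraic y)] at hx
  induction hx using Algebra.adjoin_induction with
  | mem y hy =>
    rcases sq_eq_sq_iff_eq_or_eq_neg.1 ((show y ^ 2 = _ from hy).trans hs.symm) with rfl | rfl
    · exact ⟨0, 1, by simp⟩
    · exact ⟨0, -1, by simp⟩
  | algebraMap r => exact ⟨r, 0, by simp⟩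
  | add y z _ _ hy hz =>
    obtain ⟨y₀, y₁, rfl⟩ := hy
    obtain ⟨z₀, z₁, rfl⟩ := hz
    exact ⟨y₀ + z₀, y₁ + z₁, by simp only [map_add]; ring⟩
  | mul y z _ _ hy hz =>
    obtain ⟨y₀, y₁, rfl⟩ := hy
    obtain ⟨z₀, z₁, rfl⟩ := hz
    refine ⟨y₀ * z₀ + D * y₁ * z₁, y₀ * z₁ + y₁ * z₀, ?_⟩
    simp only [map_add, map_mul]
    linear_combination
      (algebraMap k (AlgebraicClosure k) y₁ * algebraMap k (AlgebraicClosure k) z₁) * hs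

/-- The alternative f = 0 is absorbed because the norm form represents 0 trivially. -/
theorem eq_zero_or_hilbertSymbolEqZero_iff {E : Type v} [Field E] [Algebra k E] {a f : k}
    (h2 : (2 : k) ≠ 0) (ha : a ≠ 0) :
    (f = 0 ∨ (f ≠ 0 ∧ HilbertSymbolEqZero E (algebraMap k E a) (algebraMap k E f))) ↔
      ∃ x y : E, x ^ 2 - algebraMap k E a * y ^ 2 = algebraMap k E f := by
  have h2' : (2 : E) ≠ 0 := map_ofNat (algebraMap k E) 2 ▸ (map_ne_zero _).2 h2
  by_cases hf : f = 0
  · simp only [hf, true_or, map_zero, true_iff]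
    exact ⟨0, 0, by simp⟩
  · simp only [hf, false_or, ne_eq, not_false_eq_true, true_and]
    exact hilbertSymbolEqZero_iff h2' ((map_ne_zero _).2 ha) ((map_ne_zero _).2 hf)

end SqrtField

/-! ### The equivalences. -/

theorem theorem1p2 {k : Type u} [Field k] [Infinite k] (hchar : ringChar k ≠ 2)
    (a b c d : k) (ha : ¬ IsSquare a) (hb : ¬ IsSquare b) (hcd : c ≠ 0 ∨ d ≠ 0)
    {L₀ : Type v} [Field L₀] [Algebra k L₀] (t₁ t₂ t₃ t₄ : L₀)
    (hgen : IntermediateField.adjoin k {t₁, t₂, t₃, t₄} = ⊤)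
    (htrdeg : Algebra.trdeg k L₀ = 2)
    (hrel₁ : t₁ ^ 2 - algebraMap k L₀ a * t₂ ^ 2 = algebraMap k L₀ b)
    (hrel₂ : t₃ ^ 2 - algebraMap k L₀ a * t₄ ^ 2 =
      2 * algebraMap k L₀ c * t₁ + algebraMap k L₀ d) :
    List.TFAE [
      IsRationalExt k L₀,
      IsStablyRationalExt k L₀,
      IsUnirationalExt k L₀,
      ∃ α β γ δ : k, α ^ 2 - a * β ^ 2 = b ∧ γ ^ 2 - a * δ ^ 2 = 2 * c * α + d,
      ∃ α β : k, α ^ 2 - a * β ^ 2 = b ∧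
        (-2 * c * α + d = 0 ∨
          (-2 * c * α + d ≠ 0 ∧
            HilbertSymbolEqZero (sqrtField k (d ^ 2 - 4 * b * c ^ 2))
              (algebraMap k (sqrtField k (d ^ 2 - 4 * b * c ^ 2)) a)
              (algebraMap k (sqrtField k (d ^ 2 - 4 * b * c ^ 2)) (-2 * c * α + d)))),
      HilbertSymbolEqZero k a b ∧
        ∀ α β : k, α ^ 2 - a * β ^ 2 = b →
          (-2 * c * α + d = 0 ∨
            (-2 * c * α + d ≠ 0 ∧
              HilbertSymbolEqZero (sqrtField k (d ^ 2 - 4 * b * c ^ 2))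
                (algebraMap k (sqrtField k (d ^ 2 - 4 * b * c ^ 2)) a)
                (algebraMap k (sqrtField k (d ^ 2 - 4 * b * c ^ 2)) (-2 * c * α + d))))] := by
  have h2 : (2 : k) ≠ 0 := Ring.two_ne_zero hchar
  have ha0 : a ≠ 0 := by
    rintro rfl
    exact ha IsSquare.zero
  have hb0 : b ≠ 0 := by
    rintro rfl
    exact hb IsSquare.zero
  obtain ⟨w, hw, hspan⟩ := exists_sqrtField_generator (d ^ 2 - 4 * b * c ^ 2)
  -- From here on only `w` and its spanning property matter.
  generalize sqrtField k (d ^ 2 - 4 * b * c ^ 2) = E at w hw hspan ⊢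
  simp only [eq_zero_or_hilbertSymbolEqZero_iff (E := E) h2 ha0, hilbertSymbolEqZero_iff h2 ha0 hb0]
  have h2' : (2 : E) ≠ 0 := map_ofNat (algebraMap k E) 2 ▸ (map_ne_zero _).2 h2
  have transfer : ∀ {α β α' β' : k}, α ^ 2 - a * β ^ 2 = b → α' ^ 2 - a * β' ^ 2 = b →
      (∃ x y : E, x ^ 2 - algebraMap k E a * y ^ 2 = algebraMap k E (-2 * c * α + d)) →
      ∃ x y : E, x ^ 2 - algebraMap k E a * y ^ 2 = algebraMap k E (-2 * c * α' + d) := by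
    intro α β α' β' h h' hn
    have hβ : β ≠ 0 := by
      rintro rfl
      exact hb ⟨α, by linear_combination -h⟩
    have hE := congrArg (algebraMap k E) h
    have hE' := congrArg (algebraMap k E) h'
    simp only [map_add, map_sub, map_mul, map_neg, map_pow, map_ofNat] at hw hE hE' hn ⊢
    exact exists_norm_eq_of_conic_point h2' ((map_ne_zero _).2 ha0) ((map_ne_zero _).2 hb0)
      ((map_ne_zero _).2 hβ) (hcd.imp (map_ne_zero _).2 (map_ne_zero _).2) hw hE hE' hn
  have hneg : ∀ {α β : k}, α ^ 2 - a * β ^ 2 = b → (-α) ^ 2 - a * β ^ 2 = b := by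
    intro α β h
    simpa using h
  tfae_have 1 → 2 := IsRationalExt.isStablyRationalExt
  tfae_have 2 → 3 := IsStablyRationalExt.isUnirationalExt
  tfae_have 3 → 4 := exists_point_of_isUnirationalExt t₁ t₂ t₃ t₄ hrel₁ hrel₂
  tfae_have 4 → 1 := fun ⟨α, β, γ, δ, h, h'⟩ =>
    isRationalExt_of_point h2 ha hb hcd t₁ t₂ t₃ t₄ hgen htrdeg hrel₁ hrel₂ h h'
  tfae_have 4 → 5 := by
    rintro ⟨α, β, γ, δ, h, h'⟩
    -- 2cα + d is the value of -2c(·) + d at the reflected point (-α, β).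
    refine ⟨α, β, h, transfer (hneg h) h ⟨algebraMap k E γ, algebraMap k E δ, ?_⟩⟩
    rw [neg_mul, neg_mul_neg, ← h']
    simp
  tfae_have 5 → 6 := fun ⟨α, β, h, hn⟩ => ⟨⟨α, β, h⟩, fun α' β' h' => transfer h h' hn⟩
  tfae_have 6 → 4 := by
    rintro ⟨⟨α, β, h⟩, hn⟩
    refine exists_point_of_norm_eq_in_quadratic h2 ha h hw hspan ?_
    have := hn (-α) β (hneg h)
    rwa [neg_mul, neg_mul_neg] at this
  tfae_finish
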